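/- Let $\boldsymbol{x}_1,\boldsymbol{x}_2:\mathbb{R}\dashrightarrow\mathbb{R}^3$ be triples of rational functions with real coefficients that are proper (birational) parametrizations of nonplanar real algebraic curves $\mathcal{C}_1,\mathcal{C}_2\subset\mathbb{R}^3$, where $\mathcal{C}_j$ is the Zariski closure of the image of $\boldsymbol{x}_j$. Write the squared curvature and the torsion of $\boldsymbol{x}_j$ in lowest terms as $$\kappa_j^2=\frac{\|\boldsymbol{x}_j'\times\boldsymbol{x}_j''\|^2}{\|\boldsymbol{x}_j'\|^6}=\frac{A_j}{B_j},\qquad \tau_j=\frac{\langle\boldsymbol{x}_j'\times\boldsymbol{x}_j'',\boldsymbol{x}_j'''\rangle}{\|\boldsymbol{x}_j'\times\boldsymbol{x}_j''\|^2}=\frac{C_j}{D_j},\qquad j=1,2,$$ and assume that both curves are non-helical, that is, for $j=1,2$ the rational function $(\kappa_j/\tau_j)^2$ is not constant. In $\mathbb{R}[\lambda,t,s]$ put $$K_\lambda(t,s)=A_1(t)B_2(s)-\lambda^2A_2(s)B_1(t),\qquad T_\lambda(t,s)=C_1(t)D_2(s)-\lambda\, C_2(s)D_1(t).$$ Let $\Lambda^\star(\lambda)\in\mathbb{R}[\lambda]$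 be the content of the resultant $\mathrm{Res}_s(K_\lambda,T_\lambda)\in\mathbb{R}[\lambda][t]$ with respect to $t$ (the greatest common divisor of its coefficients as a polynomial in $t$), let $\Lambda(\lambda)$ be the product of $\Lambda^\star(\lambda)$ and the content with respect to $t$ of $\gcd(\mathrm{lc}_s K_\lambda,\mathrm{lc}_s T_\lambda)$, where $\mathrm{lc}_s$ is the leading coefficient with respect to $s$, and let $\mathcal{S}_0$ be the set of nonzero real roots of $\Lambda$. Then $\Lambda$ is not the zero polynomial, so that $\mathcal{S}_0$ is finite. Moreover, if $f(\mathcal{C}_1)=\mathcal{C}_2$ for a similarity $f(\mathbf{x})=\lambda_0\boldsymbol{Q}\mathbf{x}+\boldsymbol{b}$ with $0\neq\lambda_0\in\mathbb{R}$, $\boldsymbol{Q}\in SO(3)$ and $\boldsymbol{b}\in\mathbb{R}^3$, then $\lambda_0\in\mathcal{S}_0$. -/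

import Mathlib

open Polynomial
open scoped Matrix

noncomputable section

namespace SpaceCurve

/-- A rational parametrization `t ↦ (x(t), y(t), z(t))` of a space curve, with real coefficients. -/
abbrev Param := Fin 3 → RatFunc ℝ

/-- The formal derivative `(p' q - p q') / q²` of a rational function `p / q`. -/
def ratDeriv (f : RatFunc ℝ) : RatFunc ℝ :=
  algebraMap ℝ[X] (RatFunc ℝ) (derivative f.num * f.denom - f.num * derivative f.denom) /
    algebraMap ℝ[X] (RatFunc ℝ) (f.denom ^ 2)

/-- The componentwise derivative of a parametrization. -/
def paramDeriv (x : Param) : Param := fun i => ratDeriv (x i)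

/-- The points `x(t)`, for the real parameters `t` at which no component has a pole. -/
def image (x : Param) : Set (Fin 3 → ℝ) :=
  {p | ∃ t : ℝ, (∀ i, (x i).denom.eval t ≠ 0) ∧ ∀ i, p i = (x i).eval (RingHom.id ℝ) t}

/-- The real algebraic curve parametrized by `x`: the Zariski closure of the image of `x`. -/
def curve (x : Param) : Set (Fin 3 → ℝ) :=
  MvPolynomial.zeroLocus ℝ (MvPolynomial.vanishingIdeal ℝ (image x))

/-- `x` is proper (a birational parametrization of its curve): the components of `x` generate
the function field `ℝ(t)` of the parameter line, so that `t` is a rational function of the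
point `x(t)`. -/
def IsProper (x : Param) : Prop :=
  IntermediateField.adjoin ℝ (Set.range x) = ⊤

/-- A set of points is nonplanar when no plane `{p | a ⬝ p = d}`, `a ≠ 0`, contains it. -/
def IsNonplanar (S : Set (Fin 3 → ℝ)) : Prop :=
  ∀ (a : Fin 3 → ℝ) (d : ℝ), (∀ p ∈ S, a ⬝ᵥ p = d) → a = 0

/-- `f` is the similarity `p ↦ lam • Q p + b` with signed ratio `lam ≠ 0`, where `Q` is a
rotation matrix. -/
def IsSimilarityOfRatio (f : (Fin 3 → ℝ) → (Fin 3 → ℝ)) (lam : ℝ) : Prop :=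
  lam ≠ 0 ∧ ∃ Q ∈ Matrix.specialOrthogonalGroup (Fin 3) ℝ, ∃ b : Fin 3 → ℝ,
    ∀ p, f p = lam • (Q *ᵥ p) + b

/-- The squared curvature `κ² = ‖x' × x''‖² / ‖x'‖⁶`, a rational function of the parameter. -/
def curvatureSq (x : Param) : RatFunc ℝ :=
  let x₁ := paramDeriv x
  let x₂ := paramDeriv x₁
  ((x₁ ⨯₃ x₂) ⬝ᵥ (x₁ ⨯₃ x₂)) / (x₁ ⬝ᵥ x₁) ^ 3

/-- The torsion `τ = ⟨x' × x'', x'''⟩ / ‖x' × x''‖²`, a rational function of the parameter. -/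
def torsion (x : Param) : RatFunc ℝ :=
  let x₁ := paramDeriv x
  let x₂ := paramDeriv x₁
  let x₃ := paramDeriv x₂
  ((x₁ ⨯₃ x₂) ⬝ᵥ x₃) / ((x₁ ⨯₃ x₂) ⬝ᵥ (x₁ ⨯₃ x₂))

/-- The curve of `x` is helical: it is nonplanar, and curvature and torsion are proportional.
As `κ = √(κ²) ≥ 0` is not a rational function, while the sign of `τ` may jump at a cusp or an
inflection, this is expressed for the rational function `(κ / τ)²`. -/
def IsHelical (x : Param) : Prop :=
  IsNonplanar (curve x) ∧ ∃ c : ℝ, curvatureSq x = RatFunc.C c * torsion x ^ 2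

/-- A real polynomial in the parameter `t`, as an element of `ℝ[λ][t][s]`. -/
def inT (p : ℝ[X]) : ℝ[X][X][X] := C (p.map C)

/-- A real polynomial in the parameter `s`, as an element of `ℝ[λ][t][s]`. -/
def inS (p : ℝ[X]) : ℝ[X][X][X] := p.map (C.comp C)

/-- The indeterminate `λ`, as an element of `ℝ[λ][t][s]`. -/
def lamVar : ℝ[X][X][X] := C (C X)

/-- `K_λ(t, s) = A₁(t) B₂(s) - λ² A₂(s) B₁(t)`, where `Aⱼ / Bⱼ` is the squared curvature of `xⱼ`
in lowest terms; an element of `ℝ[λ][t][s]`. -/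
def polyK (x₁ x₂ : Param) : ℝ[X][X][X] :=
  inT (curvatureSq x₁).num * inS (curvatureSq x₂).denom -
    lamVar ^ 2 * inS (curvatureSq x₂).num * inT (curvatureSq x₁).denom

/-- `T_λ(t, s) = C₁(t) D₂(s) - λ C₂(s) D₁(t)`, where `Cⱼ / Dⱼ` is the torsion of `xⱼ`
in lowest terms; an element of `ℝ[λ][t][s]`. -/
def polyT (x₁ x₂ : Param) : ℝ[X][X][X] :=
  inT (torsion x₁).num * inS (torsion x₂).denom -
    lamVar * inS (torsion x₂).num * inT (torsion x₁).denom

/-- `Λ*(λ)`: the content with respect to `t` of the resultant of `K_λ` and `T_λ` with respect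
to `s`. -/
def LambdaStar (x₁ x₂ : Param) : ℝ[X] :=
  (resultant (polyK x₁ x₂) (polyT x₁ x₂)).content

/-- `Λ(λ)`: the product of `Λ*(λ)` and the content with respect to `t` of the greatest common
divisor of the leading coefficients of `K_λ` and `T_λ` with respect to `s`. -/
def Lambda (x₁ x₂ : Param) : ℝ[X] :=
  LambdaStar x₁ x₂ * (gcd (polyK x₁ x₂).leadingCoeff (polyT x₁ x₂).leadingCoeff).content

/-- The candidate set `S₀`: the nonzero real roots of `Λ`. -/
def candidateSet (x₁ x₂ : Param) : Set ℝ :=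
  {lam | lam ≠ 0 ∧ (Lambda x₁ x₂).eval lam = 0}

end SpaceCurve

end

noncomputable section

namespace SpaceCurve

/-! The ratio is a root: a polynomial vanishes on a curve iff it vanishes at the generic point
`x(t)`. So `f(C₁) = C₂` gives `f ∘ x₁` and `x₂` the same polynomial relations, and as `x₂` is
proper, `f ∘ x₁ = x₂ ∘ φ` with `φ = Φ t` for an endomorphism `Φ` of `ℝ(t)`
(`exists_algHom_of_similarity`). Squared curvature and torsion ignore reparametrization and scale by
`λ₀⁻²` and `λ₀⁻¹`, so at `λ = λ₀` the polynomials `K` and `T` share the root `s = φ(t)`. Their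
resultant then vanishes there identically in `t`, and so does its content (`Lambda_eval_eq_zero`).

`Λ ≠ 0`: otherwise `K` and `T` have a common root `σ` over `ℝ(t)(λ)`. Eliminating `λ` equates
`(κ₁/τ₁)²` at `t` with `(κ₂/τ₂)²` at `σ`; as the former is not constant, `σ` is algebraic over
`ℝ(t)`. Since `λ` is transcendental, `K = 0` forces `A₂(σ) = B₂(σ) = 0`, against coprimality
(`no_common_root`). -/

/-! ### Differentiation on `ℝ(t)` -/

theorem quotient_rule_numerator {R : Type*} [CommRing R] {n n' d d' p p' q q' : R}
    (h : n * q = p * d) (h' : n' * q + n * q' = p' * d + p * d') :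
    (n' * d - n * d') * q ^ 2 = (p' * q - p * q') * d ^ 2 := by
  linear_combination (q * d) * h' - (d' * q + d * q') * h

/-- Frees the quotient rule from lowest terms, which sums and products do not preserve. -/
theorem ratDeriv_of_eq_div {f : RatFunc ℝ} {p q : ℝ[X]} (hq : q ≠ 0)
    (hf : f = algebraMap ℝ[X] (RatFunc ℝ) p / algebraMap ℝ[X] (RatFunc ℝ) q) :
    ratDeriv f = algebraMap ℝ[X] (RatFunc ℝ) (derivative p * q - p * derivative q) /
      algebraMap ℝ[X] (RatFunc ℝ) (q ^ 2) := by
  have key : f.num * q = p * f.denom := (RatFunc.num_mul_eq_mul_denom_iff hq).2 hf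
  have hd := RatFunc.denom_ne_zero f
  have key' := congrArg derivative key
  rw [derivative_mul, derivative_mul] at key'
  rw [ratDeriv, div_eq_div_iff (RatFunc.algebraMap_ne_zero (pow_ne_zero 2 hd))
    (RatFunc.algebraMap_ne_zero (pow_ne_zero 2 hq)), ← map_mul, ← map_mul]
  exact congrArg _ (quotient_rule_numerator key key')

theorem ratDeriv_div (p q : ℝ[X]) (hq : q ≠ 0) :
    ratDeriv (algebraMap ℝ[X] (RatFunc ℝ) p / algebraMap ℝ[X] (RatFunc ℝ) q) =
      algebraMap ℝ[X] (RatFunc ℝ) (derivative p * q - p * derivative q) /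
        algebraMap ℝ[X] (RatFunc ℝ) (q ^ 2) :=
  ratDeriv_of_eq_div hq rfl

theorem ratDeriv_add (f g : RatFunc ℝ) : ratDeriv (f + g) = ratDeriv f + ratDeriv g := by
  induction f using RatFunc.induction_on with | f p q hq =>
  induction g using RatFunc.induction_on with | f r s hs =>
  have hq' := RatFunc.algebraMap_ne_zero hq
  have hs' := RatFunc.algebraMap_ne_zero hs
  have h : algebraMap ℝ[X] (RatFunc ℝ) p / algebraMap ℝ[X] (RatFunc ℝ) q +
      algebraMap ℝ[X] (RatFunc ℝ) r / algebraMap ℝ[X] (RatFunc ℝ) s =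
      algebraMap ℝ[X] (RatFunc ℝ) (p * s + r * q) / algebraMap ℝ[X] (RatFunc ℝ) (q * s) := by
    simp only [map_add, map_mul]
    field_simp
  rw [h, ratDeriv_div _ _ (mul_ne_zero hq hs), ratDeriv_div _ _ hq, ratDeriv_div _ _ hs]
  simp only [map_add, map_mul, map_sub, map_pow, derivative_mul]
  field_simp
  ring

theorem ratDeriv_mul (f g : RatFunc ℝ) : ratDeriv (f * g) = f * ratDeriv g + g * ratDeriv f := by
  induction f using RatFunc.induction_on with | f p q hq =>
  induction g using RatFunc.induction_on with | f r s hs =>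
  have hq' := RatFunc.algebraMap_ne_zero hq
  have hs' := RatFunc.algebraMap_ne_zero hs
  rw [div_mul_div_comm, ← map_mul, ← map_mul, ratDeriv_div _ _ (mul_ne_zero hq hs),
    ratDeriv_div _ _ hq, ratDeriv_div _ _ hs]
  simp only [map_add, map_mul, map_sub, map_pow, derivative_mul]
  field_simp
  ring

theorem ratDeriv_C (c : ℝ) : ratDeriv (RatFunc.C c) = 0 := by
  simp [ratDeriv]

/-- Differentiation of rational functions as a derivation of `ℝ(t)` over `ℝ`. -/
def ratDerivation : Derivation ℝ (RatFunc ℝ) (RatFunc ℝ) :=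
  Derivation.mk'
    { toFun := ratDeriv
      map_add' := ratDeriv_add
      map_smul' := fun c f => by
        simp only [RatFunc.smul_eq_C_mul, ratDeriv_mul, ratDeriv_C, mul_zero, add_zero,
          RingHom.id_apply] }
    ratDeriv_mul

/-- In lowest terms `n' d = n d'` gives `d ∣ d'`, so `d' = 0` by degree, and then `n' = 0`. -/
theorem eq_C_of_ratDeriv_eq_zero {f : RatFunc ℝ} (hf : ratDeriv f = 0) :
    ∃ c : ℝ, f = RatFunc.C c := by
  have hd := RatFunc.denom_ne_zero f
  rw [ratDeriv, div_eq_zero_iff, or_iff_left (RatFunc.algebraMap_ne_zero (pow_ne_zero 2 hd)),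
    map_eq_zero_iff _ (RatFunc.algebraMap_injective ℝ), sub_eq_zero] at hf
  have hdvd : f.denom ∣ derivative f.denom :=
    (RatFunc.isCoprime_num_denom f).symm.dvd_of_dvd_mul_left ⟨derivative f.num, by
      rw [← hf, mul_comm]⟩
  have hd' : derivative f.denom = 0 := by
    by_contra h
    exact absurd (degree_le_of_dvd hdvd h) (not_le.2 (degree_derivative_lt hd))
  have hn' : derivative f.num = 0 := by
    rw [hd', mul_zero] at hf
    exact (mul_eq_zero.1 hf).resolve_right hd
  have h1 := derivative_eq_zero.1 hd'
  have h2 := derivative_eq_zero.1 hn'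
  refine ⟨f.num.coeff 0 / f.denom.coeff 0, ?_⟩
  conv_lhs => rw [← RatFunc.num_div_denom f, eq_C_of_natDegree_eq_zero h1,
    eq_C_of_natDegree_eq_zero h2]
  rw [RatFunc.algebraMap_C, RatFunc.algebraMap_C, map_div₀]

/-- The chain rule: an endomorphism `Φ` of `ℝ(t)` over `ℝ` is the substitution of `Φ t`
for `t`. -/
theorem ratDeriv_algHom (Φ : RatFunc ℝ →ₐ[ℝ] RatFunc ℝ) (f : RatFunc ℝ) :
    ratDeriv (Φ f) = Φ (ratDeriv f) * ratDeriv (Φ RatFunc.X) := by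
  have hpoly (p : ℝ[X]) : Φ (algebraMap ℝ[X] (RatFunc ℝ) p) = aeval (Φ RatFunc.X) p := by
    rw [← RatFunc.aeval_X_left_eq_algebraMap, aeval_algHom_apply]
  have hder (p : ℝ[X]) : ratDeriv (Φ (algebraMap ℝ[X] (RatFunc ℝ) p)) =
      Φ (algebraMap ℝ[X] (RatFunc ℝ) (derivative p)) * ratDeriv (Φ RatFunc.X) := by
    rw [hpoly, hpoly]
    exact ratDerivation.map_aeval p (Φ RatFunc.X)
  have hd : Φ (algebraMap ℝ[X] (RatFunc ℝ) f.denom) ≠ 0 :=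
    (map_ne_zero Φ).2 (RatFunc.algebraMap_ne_zero (RatFunc.denom_ne_zero f))
  have h : Φ f * Φ (algebraMap ℝ[X] (RatFunc ℝ) f.denom) =
      Φ (algebraMap ℝ[X] (RatFunc ℝ) f.num) := by
    rw [← map_mul, ← (div_eq_iff (RatFunc.algebraMap_ne_zero (RatFunc.denom_ne_zero f))).1
      (RatFunc.num_div_denom f)]
  have h' := congrArg ratDeriv h
  rw [ratDeriv_mul, hder, hder] at h'
  have h2 : Φ (ratDeriv f) * Φ (algebraMap ℝ[X] (RatFunc ℝ) f.denom) ^ 2 =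
      Φ (algebraMap ℝ[X] (RatFunc ℝ) (derivative f.num * f.denom - f.num * derivative f.denom)) := by
    rw [ratDeriv, ← map_pow, ← map_mul, ← map_pow (algebraMap ℝ[X] (RatFunc ℝ)), div_mul_cancel₀ _
      (RatFunc.algebraMap_ne_zero (pow_ne_zero 2 (RatFunc.denom_ne_zero f)))]
  simp only [map_sub, map_mul] at h2
  apply mul_right_cancel₀ (pow_ne_zero 2 hd)
  linear_combination Φ (algebraMap ℝ[X] (RatFunc ℝ) f.denom) * h' -
    ratDeriv (Φ RatFunc.X) * h2 - Φ (algebraMap ℝ[X] (RatFunc ℝ) (derivative f.denom)) *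
      ratDeriv (Φ RatFunc.X) * h

/-! ### Values at real parameters and the generic point -/

/-- The rational function `f` is regular at `t` with value `v`. -/
def HasValueAt (t : ℝ) (f : RatFunc ℝ) (v : ℝ) : Prop :=
  ∃ p q : ℝ[X], q.eval t ≠ 0 ∧
    f * algebraMap ℝ[X] (RatFunc ℝ) q = algebraMap ℝ[X] (RatFunc ℝ) p ∧ p.eval t = v * q.eval t

theorem HasValueAt.const (t c : ℝ) : HasValueAt t (algebraMap ℝ (RatFunc ℝ) c) c :=
  ⟨C c, 1, by simp, by simp, by simp⟩

theorem HasValueAt.add {t v w : ℝ} {f g : RatFunc ℝ} (hf : HasValueAt t f v)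
    (hg : HasValueAt t g w) : HasValueAt t (f + g) (v + w) := by
  obtain ⟨p, q, hq, hp, hv⟩ := hf
  obtain ⟨r, s, hs, hr, hw⟩ := hg
  refine ⟨p * s + r * q, q * s, by simp [hq, hs], ?_, ?_⟩
  · simp only [map_add, map_mul, ← hp, ← hr]; ring
  · simp only [eval_add, eval_mul, hv, hw]; ring

theorem HasValueAt.mul {t v w : ℝ} {f g : RatFunc ℝ} (hf : HasValueAt t f v)
    (hg : HasValueAt t g w) : HasValueAt t (f * g) (v * w) := by
  obtain ⟨p, q, hq, hp, hv⟩ := hf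
  obtain ⟨r, s, hs, hr, hw⟩ := hg
  refine ⟨p * r, q * s, by simp [hq, hs], ?_, ?_⟩
  · simp only [map_mul, ← hp, ← hr]; ring
  · simp only [eval_mul, hv, hw]; ring

theorem hasValueAt_eval {t : ℝ} {f : RatFunc ℝ} (h : f.denom.eval t ≠ 0) :
    HasValueAt t f (f.eval (RingHom.id ℝ) t) :=
  ⟨f.num, f.denom, h, ((div_eq_iff (RatFunc.algebraMap_ne_zero (RatFunc.denom_ne_zero f))).1
    (RatFunc.num_div_denom f)).symm, by
      rw [RatFunc.eval, eval₂_id, eval₂_id, div_mul_cancel₀ _ h]⟩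

/-- The fractions witnessing a value need not be reduced, so values respect sums and products even
when factors cancel. -/
theorem HasValueAt.aeval {t : ℝ} {x : Param} {p : Fin 3 → ℝ} (h : ∀ i, HasValueAt t (x i) (p i))
    (g : MvPolynomial (Fin 3) ℝ) :
    HasValueAt t (MvPolynomial.aeval x g) (MvPolynomial.aeval p g) := by
  induction g using MvPolynomial.induction_on with
  | C a => simpa [MvPolynomial.aeval_C] using HasValueAt.const t a
  | add f g hf hg => simpa using hf.add hg
  | mul_X f i hf => simpa using hf.mul (h i)

theorem HasValueAt.eq_zero {t v : ℝ} (h : HasValueAt t 0 v) : v = 0 := by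
  obtain ⟨p, q, hq, hp, hv⟩ := h
  rw [zero_mul, eq_comm, map_eq_zero_iff _ (RatFunc.algebraMap_injective ℝ)] at hp
  rw [hp, eval_zero, eq_comm] at hv
  exact (mul_eq_zero.1 hv).resolve_right hq

theorem HasValueAt.num_eval_eq_zero {t : ℝ} {f : RatFunc ℝ} (h : HasValueAt t f 0) :
    f.num.eval t = 0 := by
  obtain ⟨p, q, hq, hp, hv⟩ := h
  have hq0 : q ≠ 0 := fun h => hq (by simp [h])
  have := congrArg (Polynomial.eval t) ((RatFunc.num_mul_eq_mul_denom_iff hq0).2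
    ((eq_div_iff (RatFunc.algebraMap_ne_zero hq0)).2 hp))
  rw [eval_mul, eval_mul, hv, zero_mul, zero_mul] at this
  exact (mul_eq_zero.1 this).resolve_right hq

theorem infinite_regular_params (x : Param) : {t : ℝ | ∀ i, (x i).denom.eval t ≠ 0}.Infinite := by
  have hne : ∏ i, (x i).denom ≠ 0 :=
    Finset.prod_ne_zero_iff.2 fun i _ => RatFunc.denom_ne_zero _
  refine ((finite_setOfPred_isRoot hne).infinite_compl).mono fun t ht i hi => ?_
  refine ht ?_
  change eval t _ = 0
  rw [eval_prod]
  exact Finset.prod_eq_zero (Finset.mem_univ i) hi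

/-- A polynomial vanishes on the curve of `x` exactly if it vanishes at `x`, as a rational
function of the parameter. -/
theorem aeval_param_eq_zero_iff (x : Param) (g : MvPolynomial (Fin 3) ℝ) :
    MvPolynomial.aeval x g = 0 ↔ ∀ p ∈ curve x, MvPolynomial.aeval p g = 0 := by
  constructor
  · refine fun hg p hp => hp g ?_
    rintro p ⟨t, ht, hpt⟩
    have := HasValueAt.aeval (fun i => (hpt i).symm ▸ hasValueAt_eval (ht i)) g
    rw [hg] at this
    exact this.eq_zero
  · intro hg
    rw [← RatFunc.num_eq_zero_iff]
    -- The numerator of `g(x(t))` vanishes at all of the infinitely many regular parameters.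
    refine eq_zero_of_infinite_isRoot _ ((infinite_regular_params x).mono fun t ht => ?_)
    have h := HasValueAt.aeval (p := fun i => (x i).eval (RingHom.id ℝ) t)
      (fun i => hasValueAt_eval (ht i)) g
    rw [hg _ (MvPolynomial.zeroLocus_vanishingIdeal_le _ ⟨t, ht, fun i => rfl⟩)] at h
    exact h.num_eval_eq_zero

/-! ### Nonplanar curves have nonzero torsion -/

theorem ratDeriv_const_mul (c : ℝ) (f : RatFunc ℝ) :
    ratDeriv (RatFunc.C c * f) = RatFunc.C c * ratDeriv f := by
  rw [ratDeriv_mul, ratDeriv_C, mul_zero, add_zero]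

/-- The relation `a · x' = 0` integrates to the equation `a · x = d` of a plane. -/
theorem eq_zero_of_isNonplanar {x : Param} (hx : IsNonplanar (curve x)) (a : Fin 3 → ℝ)
    (h : ∑ i, RatFunc.C (a i) * paramDeriv x i = 0) : a = 0 := by
  have h1 : ratDeriv (∑ i, RatFunc.C (a i) * x i) = 0 := by
    simpa only [Fin.sum_univ_three, ratDeriv_add, ratDeriv_const_mul, paramDeriv] using h
  obtain ⟨d, hd⟩ := eq_C_of_ratDeriv_eq_zero h1
  refine hx a d fun p hp => ?_
  have := (aeval_param_eq_zero_iff x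
    (∑ i, MvPolynomial.C (a i) * MvPolynomial.X i - MvPolynomial.C d)).1
    (by simp [hd]) p hp
  simpa [sub_eq_zero, dotProduct, MvPolynomial.aeval_C] using this

theorem ratDeriv_div_eq_zero {f g : RatFunc ℝ} (hg : g ≠ 0)
    (h : ratDeriv f * g = f * ratDeriv g) : ratDeriv (f / g) = 0 := by
  have := ratDeriv_mul (f / g) g
  rw [div_mul_cancel₀ _ hg] at this
  apply mul_left_cancel₀ (pow_ne_zero 2 hg)
  rw [mul_zero]
  have e : f / g * g = f := div_mul_cancel₀ _ hg
  linear_combination (-g) * this + h - ratDeriv g * e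

/-- These are the components of `(u × v) × (u × w) = det(u, v, w) u`. -/
theorem cross_mul_cross_of_triple_eq_zero {R : Type*} [CommRing R] {u v w : Fin 3 → R}
    (h : (u ⨯₃ v) ⬝ᵥ w = 0) (i j : Fin 3) :
    (u ⨯₃ w) i * (u ⨯₃ v) j = (u ⨯₃ v) i * (u ⨯₃ w) j := by
  simp only [cross_apply, dotProduct, Fin.sum_univ_three, Matrix.cons_val] at h
  fin_cases i <;> fin_cases j <;> simp [cross_apply] <;>
    first
    | ring1
    | linear_combination u 0 * h
    | linear_combination -u 0 * h
    | linear_combination u 1 * h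
    | linear_combination -u 1 * h
    | linear_combination u 2 * h
    | linear_combination -u 2 * h

/-- Without torsion, `(u × v)' = u × w` is parallel to `u × v`, so the binormal has a constant
direction `a`, normal to a plane containing the curve. -/
theorem torsion_ne_zero {x : Param} (hx : IsNonplanar (curve x)) (hκ : curvatureSq x ≠ 0) :
    torsion x ≠ 0 := by
  intro hτ
  simp only [curvatureSq, torsion] at hκ hτ
  set u := paramDeriv x with hu
  set v := paramDeriv u with hv
  set w := paramDeriv v with hw
  have hn2 : (u ⨯₃ v) ⬝ᵥ (u ⨯₃ v) ≠ 0 := fun h => hκ (by rw [h, zero_div])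
  have hdet : (u ⨯₃ v) ⬝ᵥ w = 0 := (div_eq_zero_iff.1 hτ).resolve_right hn2
  have hn : ∃ j, (u ⨯₃ v) j ≠ 0 := by
    by_contra! h
    exact hn2 (by simp [dotProduct, h])
  obtain ⟨j, hj⟩ := hn
  have hdu (i) : ratDeriv (u i) = v i := rfl
  have hdv (i) : ratDeriv (v i) = w i := rfl
  have hcross (i) : ratDeriv ((u ⨯₃ v) i) = (u ⨯₃ w) i := by
    have hsub (f g : RatFunc ℝ) : ratDeriv (f - g) = ratDeriv f - ratDeriv g :=
      ratDerivation.map_sub f g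
    fin_cases i <;> simp [cross_apply, hsub, ratDeriv_mul, hdu, hdv] <;> ring
  have hconst (i) : ∃ c : ℝ, (u ⨯₃ v) i / (u ⨯₃ v) j = RatFunc.C c := by
    apply eq_C_of_ratDeriv_eq_zero
    apply ratDeriv_div_eq_zero hj
    rw [hcross, hcross]
    exact cross_mul_cross_of_triple_eq_zero hdet i j
  choose a ha using hconst
  have ha' : a = 0 := by
    apply eq_zero_of_isNonplanar hx
    apply mul_left_cancel₀ hj
    rw [mul_zero, Finset.mul_sum]
    have := dot_self_cross u v
    rw [dotProduct] at this
    rw [← this]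
    refine Finset.sum_congr rfl fun i _ => ?_
    rw [← ha i, ← hu]
    field_simp
  -- The entry `a j` is `1` by normalization.
  have := ha j
  rw [div_self hj, ha', Pi.zero_apply, map_zero] at this
  exact one_ne_zero this

/-! ### Curvature and torsion under reparametrization and similarity -/

section Invariants

variable {L : Type*} [Field L]

/-- The expression of the squared curvature in the first two derivatives. -/
def curvatureSqOf (u v : Fin 3 → L) : L := ((u ⨯₃ v) ⬝ᵥ (u ⨯₃ v)) / (u ⬝ᵥ u) ^ 3

/-- The expression of the torsion in the first three derivatives. -/
def torsionOf (u v w : Fin 3 → L) : L := ((u ⨯₃ v) ⬝ᵥ w) / ((u ⨯₃ v) ⬝ᵥ (u ⨯₃ v))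

/-- For `p = φ'`, `q = φ''` these are the first two derivatives of `x ∘ φ`. -/
theorem cross_reparam (u v : Fin 3 → L) (p q : L) :
    (p • u) ⨯₃ (p ^ 2 • v + q • u) = p ^ 3 • (u ⨯₃ v) := by
  simp only [map_add, map_smul, LinearMap.smul_apply, cross_self, smul_zero, add_zero, smul_smul]
  congr 1
  ring

theorem curvatureSqOf_reparam (u v : Fin 3 → L) {p : L} (q : L) (hp : p ≠ 0) :
    curvatureSqOf (p • u) (p ^ 2 • v + q • u) = curvatureSqOf u v := by
  simp only [curvatureSqOf, cross_reparam, smul_dotProduct, dotProduct_smul, smul_eq_mul]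
  rw [← mul_div_mul_left _ ((u ⬝ᵥ u) ^ 3) (pow_ne_zero 6 hp)]
  congr 1 <;> ring

/-- The terms in `a` and `b` are orthogonal to `u × v`; what remains gains `p ^ 6` above and below.
-/
theorem torsionOf_reparam (u v w : Fin 3 → L) {p : L} (q a b : L) (hp : p ≠ 0) :
    torsionOf (p • u) (p ^ 2 • v + q • u) (p ^ 3 • w + a • v + b • u) = torsionOf u v w := by
  have hv : (u ⨯₃ v) ⬝ᵥ v = 0 := by rw [dotProduct_comm, dot_cross_self]
  have hu : (u ⨯₃ v) ⬝ᵥ u = 0 := by rw [dotProduct_comm, dot_self_cross]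
  simp only [torsionOf, cross_reparam, smul_dotProduct, dotProduct_smul, smul_eq_mul,
    dotProduct_add, hu, hv]
  rw [← mul_div_mul_left _ ((u ⨯₃ v) ⬝ᵥ (u ⨯₃ v)) (pow_ne_zero 6 hp)]
  congr 1 <;> ring

theorem dotProduct_mulVec_of_orthogonal {Q : Matrix (Fin 3) (Fin 3) L} (hQ : Qᵀ * Q = 1)
    (u v : Fin 3 → L) : (Q *ᵥ u) ⬝ᵥ (Q *ᵥ v) = u ⬝ᵥ v := by
  rw [Matrix.dotProduct_mulVec, ← Matrix.mulVec_transpose, Matrix.mulVec_mulVec, hQ,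
    Matrix.one_mulVec]

theorem triple_mulVec (Q : Matrix (Fin 3) (Fin 3) L) (u v w : Fin 3 → L) :
    ((Q *ᵥ u) ⨯₃ (Q *ᵥ v)) ⬝ᵥ (Q *ᵥ w) = Q.det * ((u ⨯₃ v) ⬝ᵥ w) := by
  simp only [cross_apply, dotProduct, Matrix.mulVec, Fin.sum_univ_three, Matrix.cons_val,
    Matrix.det_fin_three]
  ring

theorem curvatureSqOf_similarity {Q : Matrix (Fin 3) (Fin 3) L} (hQ : Qᵀ * Q = 1) {c : L}
    (hc : c ≠ 0) (u v : Fin 3 → L) :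
    c ^ 2 * curvatureSqOf (c • (Q *ᵥ u)) (c • (Q *ᵥ v)) = curvatureSqOf u v := by
  simp only [curvatureSqOf, cross_dot_cross, smul_dotProduct, dotProduct_smul, smul_eq_mul,
    dotProduct_mulVec_of_orthogonal hQ]
  rw [← mul_div_mul_left _ ((u ⬝ᵥ u) ^ 3) (pow_ne_zero 6 hc), ← mul_div_assoc]
  congr 1 <;> ring

/-- Torsion changes sign under reflections, so orthogonality alone does not suffice. -/
theorem torsionOf_similarity {Q : Matrix (Fin 3) (Fin 3) L} (hQ : Qᵀ * Q = 1) (hdet : Q.det = 1)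
    {c : L} (hc : c ≠ 0) (u v w : Fin 3 → L) :
    c * torsionOf (c • (Q *ᵥ u)) (c • (Q *ᵥ v)) (c • (Q *ᵥ w)) = torsionOf u v w := by
  simp only [torsionOf, map_smul, LinearMap.smul_apply, smul_dotProduct, dotProduct_smul,
    smul_eq_mul, triple_mulVec, hdet, one_mul]
  simp only [cross_dot_cross, dotProduct_mulVec_of_orthogonal hQ]
  rw [← mul_div_mul_left _ (u ⬝ᵥ u * _ - _) (pow_ne_zero 4 hc), ← mul_div_assoc]
  congr 1 <;> ring

theorem map_curvatureSqOf {M : Type*} [Field M] (Φ : L →+* M) (u v : Fin 3 → L) :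
    Φ (curvatureSqOf u v) = curvatureSqOf (Φ ∘ u) (Φ ∘ v) := by
  simp [curvatureSqOf, cross_apply, dotProduct, Fin.sum_univ_three]

theorem map_torsionOf {M : Type*} [Field M] (Φ : L →+* M) (u v w : Fin 3 → L) :
    Φ (torsionOf u v w) = torsionOf (Φ ∘ u) (Φ ∘ v) (Φ ∘ w) := by
  simp [torsionOf, cross_apply, dotProduct, Fin.sum_univ_three]

end Invariants

theorem curvatureSq_eq (x : Param) :
    curvatureSq x = curvatureSqOf (paramDeriv x) (paramDeriv (paramDeriv x)) := rfl

theorem torsion_eq (x : Param) :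
    torsion x = torsionOf (paramDeriv x) (paramDeriv (paramDeriv x))
      (paramDeriv (paramDeriv (paramDeriv x))) := rfl

theorem paramDeriv_add (x y : Param) : paramDeriv (x + y) = paramDeriv x + paramDeriv y :=
  funext fun _ => ratDeriv_add _ _

theorem paramDeriv_smul (f : RatFunc ℝ) (x : Param) :
    paramDeriv (f • x) = f • paramDeriv x + ratDeriv f • x :=
  funext fun i => (ratDeriv_mul f (x i)).trans (by simp [mul_comm, paramDeriv])

theorem paramDeriv_algHom_comp (Φ : RatFunc ℝ →ₐ[ℝ] RatFunc ℝ) (x : Param) :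
    paramDeriv (Φ ∘ x) = ratDeriv (Φ RatFunc.X) • (Φ ∘ paramDeriv x) :=
  funext fun i => (ratDeriv_algHom Φ (x i)).trans (mul_comm _ _)

theorem paramDeriv_similarity (c : ℝ) (Q : Matrix (Fin 3) (Fin 3) ℝ) (x : Param) :
    paramDeriv (RatFunc.C c • (Q.map RatFunc.C *ᵥ x)) =
      RatFunc.C c • (Q.map RatFunc.C *ᵥ paramDeriv x) := by
  funext i
  simp [paramDeriv, ratDeriv_const_mul, Matrix.mulVec, dotProduct, Fin.sum_univ_three,
    ratDeriv_add]

/-- Squared curvature and torsion do not change when a nonconstant rational function is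
substituted for the parameter. -/
theorem curvatureSq_torsion_algHom_comp (Φ : RatFunc ℝ →ₐ[ℝ] RatFunc ℝ) (x : Param)
    (hp : ratDeriv (Φ RatFunc.X) ≠ 0) :
    curvatureSq (Φ ∘ x) = Φ (curvatureSq x) ∧ torsion (Φ ∘ x) = Φ (torsion x) := by
  set p := ratDeriv (Φ RatFunc.X) with hpdef
  have h1 : paramDeriv (Φ ∘ x) = p • (Φ ∘ paramDeriv x) := paramDeriv_algHom_comp Φ x
  have h2 : paramDeriv (paramDeriv (Φ ∘ x)) =
      p ^ 2 • (Φ ∘ paramDeriv (paramDeriv x)) + ratDeriv p • (Φ ∘ paramDeriv x) := by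
    rw [h1, paramDeriv_smul, paramDeriv_algHom_comp, ← hpdef, smul_smul, pow_two]
  have h3 : paramDeriv (paramDeriv (paramDeriv (Φ ∘ x))) =
      p ^ 3 • (Φ ∘ paramDeriv (paramDeriv (paramDeriv x))) +
        (3 * (p * ratDeriv p)) • (Φ ∘ paramDeriv (paramDeriv x)) +
        ratDeriv (ratDeriv p) • (Φ ∘ paramDeriv x) := by
    rw [h2, paramDeriv_add, paramDeriv_smul, paramDeriv_smul, paramDeriv_algHom_comp,
      paramDeriv_algHom_comp, ← hpdef, smul_smul, smul_smul, pow_two, ratDeriv_mul]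
    funext i
    simp only [Pi.add_apply, Pi.smul_apply, smul_eq_mul]
    ring
  constructor
  · rw [curvatureSq_eq, curvatureSq_eq, h2, h1, curvatureSqOf_reparam _ _ _ hp]
    exact (map_curvatureSqOf (Φ : RatFunc ℝ →+* RatFunc ℝ) _ _).symm
  · rw [torsion_eq, torsion_eq, h3, h2, h1, torsionOf_reparam _ _ _ _ _ _ hp]
    exact (map_torsionOf (Φ : RatFunc ℝ →+* RatFunc ℝ) _ _ _).symm

theorem map_C_transpose_mul_self {Q : Matrix (Fin 3) (Fin 3) ℝ}
    (hQ : Q ∈ Matrix.specialOrthogonalGroup (Fin 3) ℝ) :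
    (Q.map (RatFunc.C : ℝ →+* RatFunc ℝ))ᵀ * Q.map RatFunc.C = 1 ∧
      (Q.map (RatFunc.C : ℝ →+* RatFunc ℝ)).det = 1 := by
  rw [Matrix.mem_specialOrthogonalGroup_iff] at hQ
  constructor
  · rw [← Matrix.transpose_map, ← Matrix.map_mul, (Matrix.mem_orthogonalGroup_iff' _ _).1 hQ.1]
    simp
  · have := (RatFunc.C : ℝ →+* RatFunc ℝ).map_det Q
    rw [hQ.2, map_one] at this
    exact this.symm

theorem curvatureSq_torsion_of_similarity {x y : Param} {c : ℝ} (hc : c ≠ 0)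
    {Q : Matrix (Fin 3) (Fin 3) ℝ} (hQ : Q ∈ Matrix.specialOrthogonalGroup (Fin 3) ℝ)
    (h : paramDeriv y = RatFunc.C c • (Q.map RatFunc.C *ᵥ paramDeriv x)) :
    RatFunc.C c ^ 2 * curvatureSq y = curvatureSq x ∧ RatFunc.C c * torsion y = torsion x := by
  obtain ⟨hQ1, hQ2⟩ := map_C_transpose_mul_self hQ
  have hc' : (RatFunc.C c : RatFunc ℝ) ≠ 0 := (_root_.map_ne_zero _).2 hc
  rw [curvatureSq_eq, curvatureSq_eq, torsion_eq, torsion_eq, h]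
  simp only [paramDeriv_similarity]
  exact ⟨curvatureSqOf_similarity hQ1 hc' _ _, torsionOf_similarity hQ1 hQ2 hc' _ _ _⟩

/-! ### From a similarity to a substitution of the parameter -/

/-- Parametrizations with the same polynomial relations differ by a substitution of the
parameter, if the first one is proper. -/
theorem exists_algHom_comp_eq {x z : Param} (hx : IsProper x)
    (h : ∀ g : MvPolynomial (Fin 3) ℝ, MvPolynomial.aeval x g = 0 ↔ MvPolynomial.aeval z g = 0) :
    ∃ Φ : RatFunc ℝ →ₐ[ℝ] RatFunc ℝ, Φ ∘ x = z := by
  let I := RingHom.ker (MvPolynomial.aeval (R := ℝ) x)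
  let R := MvPolynomial (Fin 3) ℝ ⧸ I
  have : I.IsPrime := RingHom.ker_isPrime _
  let g₁ : R →ₐ[ℝ] RatFunc ℝ := Ideal.Quotient.liftₐ I (MvPolynomial.aeval x) fun a ha => ha
  let g₂ : R →ₐ[ℝ] RatFunc ℝ :=
    Ideal.Quotient.liftₐ I (MvPolynomial.aeval z) fun a ha => (h a).1 ha
  have hg₁ : Function.Injective g₁ :=
    (injective_iff_map_eq_zero g₁).2 fun a => by
      obtain ⟨a, rfl⟩ := Ideal.Quotient.mk_surjective a
      exact fun ha => Ideal.Quotient.eq_zero_iff_mem.2 ha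
  have hg₂ : Function.Injective g₂ :=
    (injective_iff_map_eq_zero g₂).2 fun a => by
      obtain ⟨a, rfl⟩ := Ideal.Quotient.mk_surjective a
      exact fun ha => Ideal.Quotient.eq_zero_iff_mem.2 ((h a).2 ha)
  let Φ₁ : FractionRing R →ₐ[ℝ] RatFunc ℝ := IsFractionRing.liftAlgHom hg₁
  let Φ₂ : FractionRing R →ₐ[ℝ] RatFunc ℝ := IsFractionRing.liftAlgHom hg₂
  have hX₁ (i) : Φ₁ (algebraMap R _ (Ideal.Quotient.mk I (MvPolynomial.X i))) = x i :=
    (IsFractionRing.lift_algebraMap hg₁ _).trans (MvPolynomial.aeval_X x i)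
  have hX₂ (i) : Φ₂ (algebraMap R _ (Ideal.Quotient.mk I (MvPolynomial.X i))) = z i :=
    (IsFractionRing.lift_algebraMap hg₂ _).trans (MvPolynomial.aeval_X z i)
  -- Properness identifies the function field of the curve with `ℝ(t)`; the substitution is `Φ₂ ∘
  -- Φ₁⁻¹`.
  have hsurj : Function.Surjective Φ₁ := by
    rw [← AlgHom.fieldRange_eq_top, eq_top_iff, ← hx, IntermediateField.adjoin_le_iff]
    rintro _ ⟨i, rfl⟩
    exact ⟨_, hX₁ i⟩
  let e := AlgEquiv.ofBijective Φ₁ ⟨Φ₁.toRingHom.injective, hsurj⟩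
  refine ⟨Φ₂.comp e.symm, funext fun i => ?_⟩
  have : e.symm (x i) = algebraMap R _ (Ideal.Quotient.mk I (MvPolynomial.X i)) :=
    e.symm_apply_eq.2 (hX₁ i).symm
  exact (congrArg Φ₂ this).trans (hX₂ i)

/-- A similarity of proper curves matches their curvatures and torsions along a substitution of
the parameter. -/
theorem exists_algHom_of_similarity {x₁ x₂ : Param} (hproper : IsProper x₂)
    (hκ : curvatureSq x₁ ≠ 0) {f : (Fin 3 → ℝ) → (Fin 3 → ℝ)} {c : ℝ}
    (hf : IsSimilarityOfRatio f c) (hcurve : f '' curve x₁ = curve x₂) :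
    ∃ Φ : RatFunc ℝ →ₐ[ℝ] RatFunc ℝ,
      curvatureSq x₁ = RatFunc.C c ^ 2 * Φ (curvatureSq x₂) ∧
        torsion x₁ = RatFunc.C c * Φ (torsion x₂) := by
  obtain ⟨hc, Q, hQ, b, hfQ⟩ := hf
  -- The coordinates of `f` as polynomials, so that `z` is `f ∘ x₁`.
  let F (i : Fin 3) : MvPolynomial (Fin 3) ℝ :=
    MvPolynomial.C c * ∑ j, MvPolynomial.C (Q i j) * MvPolynomial.X j + MvPolynomial.C (b i)
  let z : Param := fun i => MvPolynomial.aeval x₁ (F i)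
  have hFp (p : Fin 3 → ℝ) : (fun i => MvPolynomial.aeval p (F i)) = f p := by
    funext i
    simp [F, hfQ, Matrix.mulVec, dotProduct]
  have hz : z = RatFunc.C c • (Q.map RatFunc.C *ᵥ x₁) + fun i => RatFunc.C (b i) := by
    funext i
    simp [z, F, Matrix.mulVec, dotProduct]
  have hker (g : MvPolynomial (Fin 3) ℝ) :
      MvPolynomial.aeval x₂ g = 0 ↔ MvPolynomial.aeval z g = 0 := by
    have hbind {A : Type} [CommRing A] [Algebra ℝ A] (y : Fin 3 → A) :
        MvPolynomial.aeval (fun i => MvPolynomial.aeval y (F i)) g =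
          MvPolynomial.aeval y (MvPolynomial.bind₁ F g) := by
      rw [MvPolynomial.aeval_bind₁]
    rw [hbind, aeval_param_eq_zero_iff, aeval_param_eq_zero_iff, ← hcurve, Set.forall_mem_image]
    refine forall₂_congr fun p _ => ?_
    rw [← hbind, hFp]
  obtain ⟨Φ, hΦ⟩ := exists_algHom_comp_eq hproper hker
  have hz' : paramDeriv z = RatFunc.C c • (Q.map RatFunc.C *ᵥ paramDeriv x₁) := by
    rw [hz, paramDeriv_add, paramDeriv_similarity]
    have : paramDeriv (fun i => RatFunc.C (b i)) = 0 := funext fun i => ratDeriv_C _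
    rw [this, add_zero]
  obtain ⟨h1, h2⟩ := curvatureSq_torsion_of_similarity hc hQ hz'
  -- A constant substitution would make `z' = 0`, hence `κ₁² = 0`.
  have hp : ratDeriv (Φ RatFunc.X) ≠ 0 := by
    intro hp
    have : paramDeriv z = 0 := by rw [← hΦ, paramDeriv_algHom_comp, hp, zero_smul]
    apply hκ
    rw [← h1, curvatureSq_eq, this]
    simp [curvatureSqOf]
  obtain ⟨h3, h4⟩ := curvatureSq_torsion_algHom_comp Φ x₂ hp
  rw [hΦ] at h3 h4
  exact ⟨Φ, by rw [← h3, h1], by rw [← h4, h2]⟩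

/-! ### Resultants, specialization and contents -/

/-- The resultant is a combination of `f` and `g`, except when both are constant: then it is `1`. -/
theorem map_resultant_eq_zero {R S : Type*} [CommRing R] [CommRing S] (θ : R →+* S) (s : S)
    {f g : R[X]} (hf : f.eval₂ θ s = 0) (hg : g.eval₂ θ s = 0)
    (h : f.natDegree ≠ 0 ∨ g.natDegree ≠ 0) : θ (resultant f g) = 0 := by
  obtain ⟨p, q, -, -, e⟩ := exists_mul_add_mul_eq_C_resultant f g le_rfl le_rfl h
  have := congrArg (eval₂ θ s) e
  rw [eval₂_add, eval₂_mul, eval₂_mul, hf, hg, zero_mul, zero_mul, add_zero, eval₂_C] at this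
  exact this.symm

theorem exists_common_root_of_resultant_eq_zero {R L Ω : Type*} [CommRing R] [Field L]
    [Field Ω] [IsAlgClosed Ω] [Algebra L Ω] {θ : R →+* L} (hθ : Function.Injective θ) {f g : R[X]}
    (h : resultant f g = 0) :
    ∃ σ : Ω, f.eval₂ ((algebraMap L Ω).comp θ) σ = 0 ∧ g.eval₂ ((algebraMap L Ω).comp θ) σ = 0 := by
  have h' : resultant (f.map θ) (g.map θ) = 0 := by
    rw [natDegree_map_eq_of_injective hθ, natDegree_map_eq_of_injective hθ, resultant_map_map, h,
      map_zero]
  have := (isCoprime_iff_aeval_ne_zero_of_isAlgClosed L Ω (f.map θ) (g.map θ)).not.1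
    (resultant_eq_zero_iff.1 h').2
  push Not at this
  obtain ⟨σ, h1, h2⟩ := this
  rw [aeval_def, eval₂_map] at h1 h2
  exact ⟨σ, h1, h2⟩

section Evaluation

variable {E : Type*} [CommRing E] [Algebra ℝ E] {θ : ℝ[X][X] →+* E}

theorem eval₂_inT (hθ : ∀ a : ℝ, θ (C (C a)) = algebraMap ℝ E a) (s : E) (p : ℝ[X]) :
    (inT p).eval₂ θ s = aeval (θ X) p := by
  rw [inT, eval₂_C, aeval_def, ← RingHom.ext hθ (f := θ.comp (C.comp C))]
  exact hom_eval₂ p (C.comp C) θ X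

theorem eval₂_inS (hθ : ∀ a : ℝ, θ (C (C a)) = algebraMap ℝ E a) (s : E) (p : ℝ[X]) :
    (inS p).eval₂ θ s = aeval s p := by
  rw [inS, eval₂_map, aeval_def, ← RingHom.ext hθ (f := θ.comp (C.comp C))]

theorem eval₂_polyK (x₁ x₂ : Param) (hθ : ∀ a : ℝ, θ (C (C a)) = algebraMap ℝ E a) (s : E) :
    (polyK x₁ x₂).eval₂ θ s =
      aeval (θ X) (curvatureSq x₁).num * aeval s (curvatureSq x₂).denom -
        θ (C X) ^ 2 * aeval s (curvatureSq x₂).num * aeval (θ X) (curvatureSq x₁).denom := by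
  simp only [polyK, eval₂_sub, eval₂_mul, eval₂_pow, eval₂_inT hθ, eval₂_inS hθ, lamVar, eval₂_C]

theorem eval₂_polyT (x₁ x₂ : Param) (hθ : ∀ a : ℝ, θ (C (C a)) = algebraMap ℝ E a) (s : E) :
    (polyT x₁ x₂).eval₂ θ s =
      aeval (θ X) (torsion x₁).num * aeval s (torsion x₂).denom -
        θ (C X) * aeval s (torsion x₂).num * aeval (θ X) (torsion x₁).denom := by
  simp only [polyT, eval₂_sub, eval₂_mul, eval₂_inT hθ, eval₂_inS hθ, lamVar, eval₂_C]

end Evaluation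

/-- The homomorphism `ℝ[λ][t] → E` over `ℝ` with `λ ↦ l` and `t ↦ t`. -/
def evalLamT {E : Type*} [CommRing E] [Algebra ℝ E] (l t : E) : ℝ[X][X] →+* E :=
  eval₂RingHom (aeval l : ℝ[X] →ₐ[ℝ] E).toRingHom t

section EvalLamT

variable {E : Type*} [CommRing E] [Algebra ℝ E] (l t : E)

theorem evalLamT_C_C (a : ℝ) : evalLamT l t (C (C a)) = algebraMap ℝ E a := by
  simp [evalLamT]

theorem evalLamT_C_X : evalLamT l t (C X) = l := by
  simp [evalLamT]

theorem evalLamT_X : evalLamT l t X = t := by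
  simp [evalLamT]

end EvalLamT

/-- If `r` vanishes at `λ = c` identically in `t`, then `λ - c` divides every coefficient, hence the
content. -/
theorem eval_content_eq_zero {c : ℝ} {r : ℝ[X][X]}
    (h : evalLamT (algebraMap ℝ (RatFunc ℝ) c) RatFunc.X r = 0) : r.content.eval c = 0 := by
  have h1 : evalLamT (algebraMap ℝ (RatFunc ℝ) c) RatFunc.X r =
      algebraMap ℝ[X] (RatFunc ℝ) (r.map (evalRingHom c)) := by
    rw [← RatFunc.aeval_X_left_eq_algebraMap, aeval_def, eval₂_map, evalLamT,
      coe_eval₂RingHom]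
    congr 1
    ext p <;> simp
  rw [h1, map_eq_zero_iff _ (RatFunc.algebraMap_injective ℝ)] at h
  have h2 : X - C c ∣ r.content := by
    rw [dvd_content_iff_C_dvd, C_dvd_iff_dvd_coeff]
    intro i
    rw [dvd_iff_isRoot, IsRoot.def, ← coe_evalRingHom, ← coeff_map, h, coeff_zero]
  exact dvd_iff_isRoot.1 h2

/-! ### Nonvanishing of `Λ` -/

theorem aeval_mem_algebraicClosure {k E : Type*} [Field k] [Field E] [Algebra k E] {σ : E}
    (hσ : IsAlgebraic k σ) (p : k[X]) : aeval σ p ∈ algebraicClosure k E := by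
  have : Algebra.adjoin k {σ} ≤ (algebraicClosure k E).toSubalgebra :=
    Algebra.adjoin_le (Set.singleton_subset_iff.2 (mem_algebraicClosure_iff.2 hσ))
  exact this (aeval_mem_adjoin_singleton k σ)

/-- Separation of variables: fix one `s` with `b(s) c(s) ≠ 0`. -/
theorem exists_eq_C_mul_of_cross_mul_eq {f g : RatFunc ℝ} {a b c d : ℝ[X]} (hb : b ≠ 0)
    (hc : c ≠ 0)
    (h : ∀ s : ℝ, f * RatFunc.C (b.eval s) * RatFunc.C (c.eval s) ^ 2 =
      g * RatFunc.C (d.eval s) ^ 2 * RatFunc.C (a.eval s)) :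
    ∃ r : ℝ, f = RatFunc.C r * g := by
  obtain ⟨s, hs⟩ : ∃ s, (b * c).eval s ≠ 0 := by
    by_contra! h
    exact mul_ne_zero hb hc (Polynomial.funext fun s => by rw [h, eval_zero])
  rw [eval_mul] at hs
  have hb' : (RatFunc.C (b.eval s) : RatFunc ℝ) ≠ 0 :=
    (_root_.map_ne_zero _).2 (left_ne_zero_of_mul hs)
  have hc' : (RatFunc.C (c.eval s) : RatFunc ℝ) ≠ 0 :=
    (_root_.map_ne_zero _).2 (right_ne_zero_of_mul hs)
  refine ⟨d.eval s ^ 2 * a.eval s / (b.eval s * c.eval s ^ 2), ?_⟩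
  simp only [map_div₀, map_mul, map_pow]
  field_simp
  linear_combination h s

/-- For generic `λ` and `t`, the polynomials `K` and `T` have no common root. -/
theorem no_common_root {E : Type*} [Field E] [Algebra ℝ E] [Algebra (RatFunc ℝ) E]
    [IsScalarTower ℝ (RatFunc ℝ) E] {x₁ x₂ : Param} (hκ₁ : curvatureSq x₁ ≠ 0)
    (hτ₂ : torsion x₂ ≠ 0) (hhel : ¬ ∃ c : ℝ, curvatureSq x₁ = RatFunc.C c * torsion x₁ ^ 2)
    {l σ : E} (hl : Transcendental (RatFunc ℝ) l)
    (hK : aeval (algebraMap (RatFunc ℝ) E RatFunc.X) (curvatureSq x₁).num *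
        aeval σ (curvatureSq x₂).denom -
      l ^ 2 * aeval σ (curvatureSq x₂).num *
        aeval (algebraMap (RatFunc ℝ) E RatFunc.X) (curvatureSq x₁).denom = 0)
    (hT : aeval (algebraMap (RatFunc ℝ) E RatFunc.X) (torsion x₁).num *
        aeval σ (torsion x₂).denom -
      l * aeval σ (torsion x₂).num *
        aeval (algebraMap (RatFunc ℝ) E RatFunc.X) (torsion x₁).denom = 0) : False := by
  simp only [aeval_algebraMap_apply, RatFunc.aeval_X_left_eq_algebraMap] at hK hT
  set j := algebraMap (RatFunc ℝ) E with hj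
  set i := algebraMap ℝ[X] (RatFunc ℝ) with hi
  have hne {p : ℝ[X]} (hp : p ≠ 0) : j (i p) ≠ 0 :=
    (_root_.map_ne_zero j).2 (RatFunc.algebraMap_ne_zero hp)
  have hA₁ := hne (RatFunc.num_ne_zero hκ₁)
  have hB₁ := hne (RatFunc.denom_ne_zero (curvatureSq x₁))
  -- The equation `(κ₁/τ₁)²(t) = (κ₂/τ₂)²(s)` cleared of denominators, free of `l`.
  let P : (RatFunc ℝ)[X] :=
    C (i (curvatureSq x₁).num * i (torsion x₁).denom ^ 2) *
        ((curvatureSq x₂).denom * (torsion x₂).num ^ 2).map (algebraMap ℝ (RatFunc ℝ)) -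
      C (i (torsion x₁).num ^ 2 * i (curvatureSq x₁).denom) *
        ((torsion x₂).denom ^ 2 * (curvatureSq x₂).num).map (algebraMap ℝ (RatFunc ℝ))
  have hP0 : aeval σ P = 0 := by
    simp only [P, map_sub, map_mul, map_pow, aeval_C, aeval_map_algebraMap, ← hj,
      Polynomial.map_mul, Polynomial.map_pow]
    linear_combination (aeval σ (torsion x₂).num * j (i (torsion x₁).denom)) ^ 2 * hK -
      aeval σ (curvatureSq x₂).num * j (i (curvatureSq x₁).denom) *
        (j (i (torsion x₁).num) * aeval σ (torsion x₂).denom +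
          l * aeval σ (torsion x₂).num * j (i (torsion x₁).denom)) * hT
  have hP : P ≠ 0 := by
    intro hP
    apply hhel
    refine exists_eq_C_mul_of_cross_mul_eq (a := (curvatureSq x₂).num)
      (d := (torsion x₂).denom) (RatFunc.denom_ne_zero (curvatureSq x₂))
      (RatFunc.num_ne_zero hτ₂) fun s => ?_
    have h := congrArg (Polynomial.eval (algebraMap ℝ (RatFunc ℝ) s)) hP
    simp only [P, eval_sub, eval_mul, eval_C, eval_map_apply, Polynomial.map_mul,
      Polynomial.map_pow, eval_pow, eval_zero, RatFunc.algebraMap_eq_C] at h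
    conv_lhs => rw [← RatFunc.num_div_denom (curvatureSq x₁)]
    conv_rhs => rw [← RatFunc.num_div_denom (torsion x₁)]
    have h1 := RatFunc.algebraMap_ne_zero (RatFunc.denom_ne_zero (curvatureSq x₁))
    have h2 := RatFunc.algebraMap_ne_zero (RatFunc.denom_ne_zero (torsion x₁))
    field_simp
    linear_combination h
  have hσ : IsAlgebraic (RatFunc ℝ) σ := ⟨P, hP, hP0⟩
  have hmem (p : ℝ[X]) : aeval σ p ∈ algebraicClosure (RatFunc ℝ) E := by
    rw [← aeval_map_algebraMap (RatFunc ℝ)]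
    exact aeval_mem_algebraicClosure hσ _
  -- Otherwise `hK` expresses `l ^ 2` by elements algebraic over `ℝ(t)`.
  have hA₂ : aeval σ (curvatureSq x₂).num = 0 := by
    by_contra hA₂
    refine hl (IsAlgebraic.of_pow two_pos (mem_algebraicClosure_iff.1 ?_))
    have : l ^ 2 = j (i (curvatureSq x₁).num) * aeval σ (curvatureSq x₂).denom /
        (aeval σ (curvatureSq x₂).num * j (i (curvatureSq x₁).denom)) := by
      rw [eq_div_iff (mul_ne_zero hA₂ hB₁)]
      linear_combination -hK
    rw [this]
    exact div_mem (mul_mem (algebraMap_mem _ _) (hmem _)) (mul_mem (hmem _) (algebraMap_mem _ _))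
  have hB₂ : aeval σ (curvatureSq x₂).denom = 0 := by
    rw [hA₂, mul_zero, zero_mul, sub_zero] at hK
    exact (mul_eq_zero.1 hK).resolve_left hA₁
  exact (aeval_ne_zero_of_isCoprime (RatFunc.isCoprime_num_denom (curvatureSq x₂)) σ).elim
    (fun h => h hA₂) fun h => h hB₂

/-- The embedding of `ℝ[λ][t]` into the field `ℝ(t)(λ)`. -/
def embedLamT : ℝ[X][X] →+* RatFunc (RatFunc ℝ) :=
  (algebraMap (RatFunc ℝ)[X] (RatFunc (RatFunc ℝ))).comp
    ((mapRingHom (algebraMap ℝ[X] (RatFunc ℝ))).comp (Bivariate.swap (R := ℝ)).toRingHom)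

theorem embedLamT_injective : Function.Injective embedLamT :=
  (RatFunc.algebraMap_injective _).comp
    ((map_injective _ (RatFunc.algebraMap_injective ℝ)).comp Bivariate.swap.injective)

theorem embedLamT_C_C (a : ℝ) :
    embedLamT (C (C a)) = algebraMap (RatFunc ℝ) _ (algebraMap ℝ (RatFunc ℝ) a) := by
  simp [embedLamT, Bivariate.swap_C_C]

theorem embedLamT_C_X : embedLamT (C X) = RatFunc.X := by
  simp [embedLamT, Bivariate.swap_X]

theorem embedLamT_X : embedLamT X = algebraMap (RatFunc ℝ) _ RatFunc.X := by
  simp [embedLamT, Bivariate.swap_Y]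

theorem resultant_polyK_polyT_ne_zero {x₁ x₂ : Param} (hκ₁ : curvatureSq x₁ ≠ 0)
    (hτ₂ : torsion x₂ ≠ 0) (hhel : ¬ ∃ c : ℝ, curvatureSq x₁ = RatFunc.C c * torsion x₁ ^ 2) :
    resultant (polyK x₁ x₂) (polyT x₁ x₂) ≠ 0 := by
  intro h
  obtain ⟨σ, hK, hT⟩ := exists_common_root_of_resultant_eq_zero
    (Ω := AlgebraicClosure (RatFunc (RatFunc ℝ))) embedLamT_injective h
  have hθ (a : ℝ) : ((algebraMap (RatFunc (RatFunc ℝ))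
      (AlgebraicClosure (RatFunc (RatFunc ℝ)))).comp embedLamT) (C (C a)) = algebraMap ℝ _ a := by
    rw [RingHom.comp_apply, embedLamT_C_C, ← IsScalarTower.algebraMap_apply,
      ← IsScalarTower.algebraMap_apply]
  rw [eval₂_polyK x₁ x₂ hθ] at hK
  rw [eval₂_polyT x₁ x₂ hθ] at hT
  simp only [RingHom.comp_apply, embedLamT_X, embedLamT_C_X,
    ← IsScalarTower.algebraMap_apply] at hK hT
  refine no_common_root hκ₁ hτ₂ hhel ?_ hK hT
  exact (transcendental_algebraMap_iff (algebraMap (RatFunc (RatFunc ℝ)) _).injective).2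
    RatFunc.transcendental_X

theorem polyK_ne_zero {x₁ x₂ : Param} (hκ₁ : curvatureSq x₁ ≠ 0) : polyK x₁ x₂ ≠ 0 := by
  intro h
  -- At `λ = 0` and `s = t`, only `A₁(t) B₂(t)` is left.
  have := eval₂_polyK x₁ x₂ (evalLamT_C_C (0 : RatFunc ℝ) RatFunc.X) RatFunc.X
  rw [h, eval₂_zero, evalLamT_C_X, evalLamT_X, zero_pow two_ne_zero, zero_mul, zero_mul, sub_zero,
    RatFunc.aeval_X_left_eq_algebraMap, RatFunc.aeval_X_left_eq_algebraMap, eq_comm] at this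
  exact mul_ne_zero (RatFunc.algebraMap_ne_zero (RatFunc.num_ne_zero hκ₁))
    (RatFunc.algebraMap_ne_zero (RatFunc.denom_ne_zero _)) this

theorem Lambda_ne_zero {x₁ x₂ : Param} (hκ₁ : curvatureSq x₁ ≠ 0)
    (hτ₂ : torsion x₂ ≠ 0) (hhel : ¬ ∃ c : ℝ, curvatureSq x₁ = RatFunc.C c * torsion x₁ ^ 2) :
    Lambda x₁ x₂ ≠ 0 := by
  refine mul_ne_zero ?_ ?_
  · rw [LambdaStar, Ne, content_eq_zero_iff]
    exact resultant_polyK_polyT_ne_zero hκ₁ hτ₂ hhel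
  · rw [Ne, content_eq_zero_iff, gcd_eq_zero_iff, leadingCoeff_eq_zero]
    exact fun h => polyK_ne_zero hκ₁ h.1

/-! ### Vanishing of `Λ` at the ratio -/

theorem eq_C_of_eval_mul_sub_eq {b : ℝ[X]} {a k : ℝ} (ha : a ≠ 0)
    (h : ∀ s : ℝ, a * b.eval s = k) : b = C (k / a) :=
  Polynomial.funext fun s => by rw [eval_C, eq_div_iff ha, ← h s, mul_comm]

/-- If `a(t) e(s) - l b(t) d(s)` does not depend on `s`, for `l ∈ {0, 1}`, then `d` and `e` are
constant. -/
theorem exists_eq_C_of_eval_indep {a b : ℝ[X]} {f : RatFunc ℝ} (ha : a ≠ 0) (hb : b ≠ 0)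
    (h₀ : ∀ t s s' : ℝ, a.eval t * f.denom.eval s = a.eval t * f.denom.eval s')
    (h₁ : ∀ t s s' : ℝ, a.eval t * f.denom.eval s - f.num.eval s * b.eval t =
      a.eval t * f.denom.eval s' - f.num.eval s' * b.eval t) :
    ∃ r : ℝ, f = RatFunc.C r := by
  obtain ⟨t, ht⟩ : ∃ t, (a * b).eval t ≠ 0 := by
    by_contra! h
    exact mul_ne_zero ha hb (Polynomial.funext fun s => by rw [h, eval_zero])
  rw [eval_mul] at ht
  -- The case `l = 0` makes the denominator constant; subtracting `l = 1` does the same for the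
  -- numerator.
  have hd := eq_C_of_eval_mul_sub_eq (left_ne_zero_of_mul ht) fun s => h₀ t s 0
  have hn := eq_C_of_eval_mul_sub_eq (b := f.num) (right_ne_zero_of_mul ht)
    (k := b.eval t * f.num.eval 0) fun s => by linear_combination h₀ t s 0 - h₁ t s 0
  refine ⟨b.eval t * f.num.eval 0 / b.eval t / (a.eval t * f.denom.eval 0 / a.eval t), ?_⟩
  conv_lhs => rw [← RatFunc.num_div_denom f, hn, hd]
  rw [RatFunc.algebraMap_C, RatFunc.algebraMap_C, ← map_div₀]

theorem eval₂_eq_of_natDegree_eq_zero {R S : Type*} [CommRing R] [CommRing S] {f : R[X]}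
    (h : f.natDegree = 0) (θ : R →+* S) (s s' : S) : f.eval₂ θ s = f.eval₂ θ s' := by
  rw [eq_C_of_natDegree_eq_zero h, eval₂_C, eval₂_C]

/-- Excludes the degenerate resultant: if neither polynomial involved `s`, then `κ₂²` and `τ₂` would
be constant, making the second curve helical. -/
theorem natDegree_ne_zero_or {x₁ x₂ : Param} (hκ₁ : curvatureSq x₁ ≠ 0) (hτ₁ : torsion x₁ ≠ 0)
    (hτ₂ : torsion x₂ ≠ 0) (hhel : ¬ ∃ c : ℝ, curvatureSq x₂ = RatFunc.C c * torsion x₂ ^ 2) :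
    (polyK x₁ x₂).natDegree ≠ 0 ∨ (polyT x₁ x₂).natDegree ≠ 0 := by
  by_contra! h
  have hK (l t s s' : ℝ) := eval₂_eq_of_natDegree_eq_zero h.1 (evalLamT l t) s s'
  have hT (l t s s' : ℝ) := eval₂_eq_of_natDegree_eq_zero h.2 (evalLamT l t) s s'
  simp only [eval₂_polyK x₁ x₂ (evalLamT_C_C _ _), eval₂_polyT x₁ x₂ (evalLamT_C_C _ _),
    evalLamT_C_X, evalLamT_X, coe_aeval_eq_eval] at hK hT
  obtain ⟨r, hr⟩ := exists_eq_C_of_eval_indep (RatFunc.num_ne_zero hκ₁)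
    (RatFunc.denom_ne_zero (curvatureSq x₁)) (f := curvatureSq x₂)
    (fun t s s' => by simpa using hK 0 t s s') fun t s s' => by simpa using hK 1 t s s'
  obtain ⟨q, hq⟩ := exists_eq_C_of_eval_indep (RatFunc.num_ne_zero hτ₁)
    (RatFunc.denom_ne_zero (torsion x₁)) (f := torsion x₂)
    (fun t s s' => by simpa using hT 0 t s s') fun t s s' => by simpa using hT 1 t s s'
  have hq0 : q ≠ 0 := by
    rintro rfl
    exact hτ₂ (by rw [hq, map_zero])
  refine hhel ⟨r / q ^ 2, ?_⟩
  rw [hr, hq, ← map_pow, ← map_mul, div_mul_cancel₀ _ (pow_ne_zero 2 hq0)]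

/-- Clears denominators in `h`; serves `K` with `c = λ₀²` and `T` with `c = λ₀`. -/
theorem aeval_num_sub_eq_zero {f g : RatFunc ℝ} (Φ : RatFunc ℝ →ₐ[ℝ] RatFunc ℝ) {c : RatFunc ℝ}
    (h : f = c * Φ g) :
    aeval RatFunc.X f.num * aeval (Φ RatFunc.X) g.denom -
      c * aeval (Φ RatFunc.X) g.num * aeval RatFunc.X f.denom = 0 := by
  rw [aeval_algHom_apply, aeval_algHom_apply]
  simp only [RatFunc.aeval_X_left_eq_algebraMap]
  have hf := RatFunc.algebraMap_ne_zero (RatFunc.denom_ne_zero f)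
  have hg := RatFunc.algebraMap_ne_zero (RatFunc.denom_ne_zero g)
  have e₁ := (div_eq_iff hf).1 (RatFunc.num_div_denom f)
  have e₂ := congrArg Φ ((div_eq_iff hg).1 (RatFunc.num_div_denom g))
  rw [map_mul] at e₂
  rw [e₁, e₂]
  linear_combination algebraMap ℝ[X] (RatFunc ℝ) f.denom *
    Φ (algebraMap ℝ[X] (RatFunc ℝ) g.denom) * h

/-- Already the factor `Λ*` vanishes, through the common root `s = Φ t`. -/
theorem Lambda_eval_eq_zero {x₁ x₂ : Param} {c : ℝ} (Φ : RatFunc ℝ →ₐ[ℝ] RatFunc ℝ)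
    (hκ : curvatureSq x₁ = RatFunc.C c ^ 2 * Φ (curvatureSq x₂))
    (hτ : torsion x₁ = RatFunc.C c * Φ (torsion x₂))
    (hdeg : (polyK x₁ x₂).natDegree ≠ 0 ∨ (polyT x₁ x₂).natDegree ≠ 0) :
    (Lambda x₁ x₂).eval c = 0 := by
  rw [Lambda, eval_mul, LambdaStar, eval_content_eq_zero, zero_mul]
  refine map_resultant_eq_zero _ (Φ RatFunc.X) ?_ ?_ hdeg
  · rw [eval₂_polyK x₁ x₂ (evalLamT_C_C _ _), evalLamT_C_X, evalLamT_X]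
    exact aeval_num_sub_eq_zero Φ hκ
  · rw [eval₂_polyT x₁ x₂ (evalLamT_C_C _ _), evalLamT_C_X, evalLamT_X]
    exact aeval_num_sub_eq_zero Φ hτ

end SpaceCurve

end

theorem mainTheorem4
    (x₁ x₂ : SpaceCurve.Param)
    (hproper₁ : SpaceCurve.IsProper x₁) (hproper₂ : SpaceCurve.IsProper x₂)
    (hnonplanar₁ : SpaceCurve.IsNonplanar (SpaceCurve.curve x₁))
    (hnonplanar₂ : SpaceCurve.IsNonplanar (SpaceCurve.curve x₂))
    (hnonhelical₁ : ¬ SpaceCurve.IsHelical x₁)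
    (hnonhelical₂ : ¬ SpaceCurve.IsHelical x₂) :
    SpaceCurve.Lambda x₁ x₂ ≠ 0 ∧
    (SpaceCurve.candidateSet x₁ x₂).Finite ∧
    ∀ (f : (Fin 3 → ℝ) → (Fin 3 → ℝ)) (lam₀ : ℝ),
      SpaceCurve.IsSimilarityOfRatio f lam₀ →
      f '' SpaceCurve.curve x₁ = SpaceCurve.curve x₂ →
      lam₀ ∈ SpaceCurve.candidateSet x₁ x₂ := by
  have hhel₁ := not_and.1 hnonhelical₁ hnonplanar₁
  have hhel₂ := not_and.1 hnonhelical₂ hnonplanar₂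
  -- Zero curvature would count as helical, with constant `0`.
  have hκ₁ : SpaceCurve.curvatureSq x₁ ≠ 0 := fun h => hhel₁ ⟨0, by rw [h, map_zero, zero_mul]⟩
  have hκ₂ : SpaceCurve.curvatureSq x₂ ≠ 0 := fun h => hhel₂ ⟨0, by rw [h, map_zero, zero_mul]⟩
  have hτ₁ := SpaceCurve.torsion_ne_zero hnonplanar₁ hκ₁
  have hτ₂ := SpaceCurve.torsion_ne_zero hnonplanar₂ hκ₂
  have hΛ := SpaceCurve.Lambda_ne_zero hκ₁ hτ₂ hhel₁
  refine ⟨hΛ, (finite_setOfPred_isRoot hΛ).subset fun c hc => hc.2, fun f c hf hcurve => ⟨hf.1, ?_⟩⟩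
  obtain ⟨Φ, hκ, hτ⟩ := SpaceCurve.exists_algHom_of_similarity hproper₂ hκ₁ hf hcurve
  exact SpaceCurve.Lambda_eval_eq_zero Φ hκ hτ
    (SpaceCurve.natDegree_ne_zero_or hκ₁ hτ₁ hτ₂ hhel₂)
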